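/- Let $\mathbf V$ be a complex vector space with a countable basis $E=(e_\ell)_{\ell\in\mathbb N^*}$, $\mathbb N^*=\{1,2,\dots\}$; write $x\mapsto\bar x$ for complex conjugation of coordinates in $E$, and identify vectors with coordinate columns. Let $\mathbf G(E)$ be the group of automorphisms $g$ of $\mathbf V$ with $g(e_\ell)=e_\ell$ for all but finitely many $\ell$. Let $\Omega$ be a block diagonal $\mathbb N^*\times\mathbb N^*$-matrix with diagonal blocks $J_1,J_2,\dots$, where either each $J_k$ is $(1)$ or $\begin{pmatrix}0&1\\1&0\end{pmatrix}$ (orthogonal case), or each $J_k$ is $\begin{pmatrix}0&1\\-1&0\end{pmatrix}$ (symplectic case). Put $\omega(x,y)={}^tx\,\Omega\,y$, $\gamma(x)=\Omega\bar x$ and $\mathbf G(E,\omega)=\{g\in\mathbf G(E):\omega(gx,gy)=\omega(x,y)\ \forall x,y\}$; for $\ell\in\mathbb N^*$ let $\ell^*$ be the unique index with $\omega(e_\ell,e_{\ell^*})\neq0$. For a decomposition $\mathbb N^*=N_+\sqcup N_-$ let $\Phi$ be the diagonal matrix with entry $1$ at $\ell\in N_+$ and $-1$ at $\ell\in N_-$,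 and put $\phi(x,y)={}^t\bar x\,\Phi\,y$, $\delta(x)=\Phi x$. Let $(\mathbf G,\mathbf K,\mathbf G^0)$ be one of the following triples. - Type A1 ($\omega$ orthogonal) and type A2 ($\omega$ symplectic): $\mathbf G=\mathbf G(E)$, $\mathbf K=\mathbf G(E,\omega)$, $\mathbf G^0=\{g\in\mathbf G:\gamma g=g\gamma\}$. - Type A3: $\mathbf G=\mathbf G(E)$, $N_+$ and $N_-$ are nonempty, $\mathbf K=\{g\in\mathbf G:\delta g=g\delta\}$, $\mathbf G^0=\{g\in\mathbf G:\phi(gx,gy)=\phi(x,y)\ \forall x,y\}$. - Type BD1 ($\omega$ orthogonal) and type C2 ($\omega$ symplectic): $\mathbf G=\mathbf G(E,\omega)$, $N_+$ and $N_-$ are nonempty, $\ell\in N_+\Leftrightarrow\ell^*\in N_+$ for all $\ell$, and $\mathbf K,\mathbf G^0$ are given by the same formulas as in type A3. - Type D3 ($\omega$ orthogonal) and type C1 ($\omega$ symplectic): $\mathbf G=\mathbf G(E,\omega)$, $\ell\in N_+\Leftrightarrow\ell^*\in N_-$ for all $\ell$, and $\mathbf K,\mathbf G^0$ are given by the same formulas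 as in type A3. A generalized flag is a chain $\mathcal F$ of subspaces of $\mathbf V$ such that every $F\in\mathcal F$ has an immediate successor or an immediate predecessor in $\mathcal F$, and every nonzero $v\in\mathbf V$ lies in $s(F)\setminus F$ for exactly one $F\in\mathcal F$ having an immediate successor $s(F)$. It is maximal if it is not properly contained in another generalized flag. It is $E$-compatible if there is a surjection $\sigma$ of $\mathbb N^*$ onto a totally ordered set $(A,\prec)$ such that $\mathcal F=\{F'_a,F''_a:a\in A\}$ with $F'_a=\langle e_\ell:\sigma(\ell)\prec a\rangle_{\mathbb C}$ and $F''_a=\langle e_\ell:\sigma(\ell)\preceq a\rangle_{\mathbb C}$. It is $\omega$-isotropic if $F\mapsto F^\perp=\{x\in\mathbf V:\omega(x,y)=0\ \forall y\in F\}$ is a well-defined involution of $\mathcal F$. Let $\mathcal F$ be an $E$-compatible maximal generalized flag, which is moreover $\omega$-isotropic in types BD1, C1, C2, D3. Let $\mathbf B_{\mathcal F}=\{g\in\mathbf G:g\mathcal F=\mathcal F\}$ and $\mathbf X=\mathbf G/\mathbf B_{\mathcal F}$. Then the set $\mathbf X/\mathbf K$ of $\mathbf K$-orbits on $\mathbf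 X$ and the set $\mathbf X/\mathbf G^0$ of $\mathbf G^0$-orbits on $\mathbf X$ are both infinite. -/

import Mathlib

open scoped Pointwise

namespace IndFlag

section Flags

variable {V : Type*} [AddCommGroup V] [Module ℂ V]

/-- `H` is the immediate successor of `F` in the chain `𝓕`
(equivalently, `F` is the immediate predecessor of `H`). -/
def IsSucc (𝓕 : Set (Submodule ℂ V)) (F H : Submodule ℂ V) : Prop :=
  F ∈ 𝓕 ∧ H ∈ 𝓕 ∧ F < H ∧ ∀ L ∈ 𝓕, ¬ (F < L ∧ L < H)

/-- A generalized flag: a chain of subspaces, each of which has an immediate successor or an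
immediate predecessor, such that every nonzero vector lies in `s(F) \ F` for a unique member `F`
having an immediate successor `s(F)`. -/
structure IsGeneralizedFlag (𝓕 : Set (Submodule ℂ V)) : Prop where
  chain : IsChain (· ≤ ·) 𝓕
  succ_or_pred : ∀ F ∈ 𝓕, (∃ H, IsSucc 𝓕 F H) ∨ (∃ H, IsSucc 𝓕 H F)
  unique_step : ∀ v : V, v ≠ 0 → ∃! F, ∃ H, IsSucc 𝓕 F H ∧ v ∈ H ∧ v ∉ F

/-- A generalized flag that is not properly contained in another generalized flag. -/
def IsMaximalGeneralizedFlag (𝓕 : Set (Submodule ℂ V)) : Prop :=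
  IsGeneralizedFlag 𝓕 ∧ ∀ 𝓗 : Set (Submodule ℂ V), IsGeneralizedFlag 𝓗 → 𝓕 ⊆ 𝓗 → 𝓗 = 𝓕

/-- The generalized flag `𝓕_σ(v) = {F'_a, F''_a : a ∈ A}`, where `F'_a` is spanned by the `v ℓ`
with `σ ℓ < a` and `F''_a` by those with `σ ℓ ≤ a`. -/
def flagOf {A : Type} [LinearOrder A] (σ : ℕ+ → A) (v : ℕ+ → V) : Set (Submodule ℂ V) :=
  {F | ∃ a : A, F = Submodule.span ℂ (v '' {ℓ | σ ℓ < a}) ∨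
    F = Submodule.span ℂ (v '' {ℓ | σ ℓ ≤ a})}

/-- Compatibility with a basis. Since `A` is an image of `ℕ+`, it is no loss to take `A : Type`. -/
def IsCompatible (𝓕 : Set (Submodule ℂ V)) (E : Module.Basis ℕ+ ℂ V) : Prop :=
  ∃ (A : Type) (_ : LinearOrder A) (σ : ℕ+ → A), Function.Surjective σ ∧ 𝓕 = flagOf σ E

/-- The orthogonal subspace `F^⊥ = {x : ω(x, y) = 0 for all y ∈ F}`. -/
def perp (ω : V →ₗ[ℂ] V →ₗ[ℂ] ℂ) (F : Submodule ℂ V) : Submodule ℂ V where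
  carrier := {x | ∀ y ∈ F, ω x y = 0}
  add_mem' := by
    intro a b ha hb y hy
    simp [ha y hy, hb y hy]
  zero_mem' := by
    intro y _
    simp
  smul_mem' := by
    intro c x hx y hy
    simp [hx y hy]

/-- `F ↦ F^⊥` is a well-defined involution of `𝓕`. -/
def IsIsotropicFlag (ω : V →ₗ[ℂ] V →ₗ[ℂ] ℂ) (𝓕 : Set (Submodule ℂ V)) : Prop :=
  ∀ F ∈ 𝓕, perp ω F ∈ 𝓕 ∧ perp ω (perp ω F) = F

end Flags

section Forms

/-- The permutation `ℓ ↦ ℓ*` attached to a decomposition of `ℕ+` into consecutive blocks of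
size 1 or 2: it fixes the blocks of size 1 and exchanges the two elements of each block of
size 2. These are exactly the involutions with `ℓ* ∈ {ℓ - 1, ℓ, ℓ + 1}` for all `ℓ`. -/
def IsBlockInvolution (ι : ℕ+ → ℕ+) : Prop :=
  ∀ ℓ, ι (ι ℓ) = ℓ ∧ ι ℓ ≤ ℓ + 1 ∧ ℓ ≤ ι ℓ + 1

/-- The block diagonal matrix `Ω` with blocks `(1)` and `(0, 1; c, 0)` placed according to `ι`.
It is used with `c = 1` (orthogonal case), and with `c = -1` and `ι` without fixed points
(symplectic case). -/
def Omega (c : ℂ) (ι : ℕ+ → ℕ+) : Matrix ℕ+ ℕ+ ℂ :=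
  fun i j => if j = ι i then (if i ≤ j then 1 else c) else 0

open Classical in
/-- The diagonal entries of `Φ`: `1` on `N₊ = N` and `-1` on `N₋ = Nᶜ`. -/
noncomputable def sgn (N : Set ℕ+) (ℓ : ℕ+) : ℂ := if ℓ ∈ N then 1 else -1

variable {V : Type*} [AddCommGroup V] [Module ℂ V]

/-- The bilinear form `ω(x, y) = ᵗx Ω y` in coordinates with respect to `E`. -/
noncomputable def omegaForm (E : Module.Basis ℕ+ ℂ V) (c : ℂ) (ι : ℕ+ → ℕ+) :
    V →ₗ[ℂ] V →ₗ[ℂ] ℂ :=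
  E.constr ℂ fun i => E.constr ℂ fun j => Omega c ι i j

/-- The antilinear map `γ(x) = Ω x̄`; the only nonzero entry of column `j` of `Ω` is in
row `ι j`. -/
noncomputable def gammaMap (E : Module.Basis ℕ+ ℂ V) (c : ℂ) (ι : ℕ+ → ℕ+) (x : V) : V :=
  (E.repr x).sum fun j a => (Omega c ι (ι j) j * starRingEnd ℂ a) • E (ι j)

/-- The Hermitian form `φ(x, y) = ᵗx̄ Φ y`. -/
noncomputable def phiForm (E : Module.Basis ℕ+ ℂ V) (N : Set ℕ+) (x y : V) : ℂ :=
  (E.repr x).sum fun ℓ a => starRingEnd ℂ a * sgn N ℓ * E.repr y ℓ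

/-- The involution `δ(x) = Φ x`. -/
noncomputable def deltaMap (E : Module.Basis ℕ+ ℂ V) (N : Set ℕ+) : V →ₗ[ℂ] V :=
  E.constr ℂ fun ℓ => sgn N ℓ • E ℓ

end Forms

section Groups

variable {V : Type*} [AddCommGroup V] [Module ℂ V]

/-- The ind-group `GL(∞) = 𝐆(E)` of automorphisms of `V` that fix `e_ℓ` for all but finitely
many `ℓ`. -/
def GLinf (E : Module.Basis ℕ+ ℂ V) : Subgroup (V ≃ₗ[ℂ] V) where
  carrier := {g | ∀ᶠ ℓ in Filter.atTop, g (E ℓ) = E ℓ}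
  mul_mem' := by
    intro a b ha hb
    filter_upwards [ha, hb] with ℓ h₁ h₂
    simp [LinearEquiv.mul_apply, h₁, h₂]
  one_mem' := by simp
  inv_mem' := by
    intro a ha
    filter_upwards [ha] with ℓ h
    exact (LinearEquiv.symm_apply_eq a).2 h.symm

/-- The automorphisms `g` with `b(gx, gy) = b(x, y)` for all `x, y`. -/
def preserving (b : V → V → ℂ) : Subgroup (V ≃ₗ[ℂ] V) where
  carrier := {g | ∀ x y, b (g x) (g y) = b x y}
  mul_mem' := by
    intro g h hg hh x y
    simp only [LinearEquiv.mul_apply]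
    rw [hg, hh]
  one_mem' := by
    intro x y
    rfl
  inv_mem' := by
    intro g hg x y
    have h := hg (g.symm x) (g.symm y)
    rw [LinearEquiv.apply_symm_apply, LinearEquiv.apply_symm_apply] at h
    exact h.symm

/-- The automorphisms `g` with `f(gx) = g f(x)` for all `x`. -/
def commuting (f : V → V) : Subgroup (V ≃ₗ[ℂ] V) where
  carrier := {g | ∀ x, f (g x) = g (f x)}
  mul_mem' := by
    intro g h hg hh x
    simp only [LinearEquiv.mul_apply]
    rw [hg, hh]
  one_mem' := by
    intro x
    rfl
  inv_mem' := by
    intro g hg x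
    have h := hg (g.symm x)
    rw [LinearEquiv.apply_symm_apply] at h
    exact ((LinearEquiv.symm_apply_eq g).2 h).symm

/-- The group `𝐆(E, ω)`. -/
noncomputable def Ginf (E : Module.Basis ℕ+ ℂ V) (c : ℂ) (ι : ℕ+ → ℕ+) :
    Subgroup (V ≃ₗ[ℂ] V) :=
  GLinf E ⊓ preserving fun x y => omegaForm E c ι x y

/-- The stabilizer of `𝓕` in `V ≃ₗ[ℂ] V`, where `g` acts on sets of subspaces by
`g 𝓕 = {g(F) : F ∈ 𝓕}`. -/
def flagStabilizer (𝓕 : Set (Submodule ℂ V)) : Subgroup (V ≃ₗ[ℂ] V) :=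
  MulAction.stabilizer (V ≃ₗ[ℂ] V) 𝓕

/-- The set `(G/B_𝓕)/H` of orbits of a subgroup `H ⊆ G` acting by left multiplication on `G/B_𝓕`,
where `B_𝓕` is the stabilizer of `𝓕` in `G`. -/
abbrev OrbitSet (G H : Subgroup (V ≃ₗ[ℂ] V)) (𝓕 : Set (Submodule ℂ V)) : Type _ :=
  MulAction.orbitRel.Quotient (H.subgroupOf G) (G ⧸ (flagStabilizer 𝓕).subgroupOf G)

end Groups

/-- The seven types, with the data they depend on: the position `ι` of the blocks of `Ω` (where
needed) and the decomposition `N₊ = N`, `N₋ = Nᶜ` (where needed). -/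
inductive Datum : Type
  | A1 (ι : ℕ+ → ℕ+) (block : IsBlockInvolution ι)
  | A2 (ι : ℕ+ → ℕ+) (block : IsBlockInvolution ι) (noFix : ∀ ℓ, ι ℓ ≠ ℓ)
  | A3 (N : Set ℕ+) (pos : N.Nonempty) (neg : Nᶜ.Nonempty)
  | BD1 (ι : ℕ+ → ℕ+) (block : IsBlockInvolution ι)
      (N : Set ℕ+) (pos : N.Nonempty) (neg : Nᶜ.Nonempty) (stable : ∀ ℓ, ℓ ∈ N ↔ ι ℓ ∈ N)
  | C1 (ι : ℕ+ → ℕ+) (block : IsBlockInvolution ι) (noFix : ∀ ℓ, ι ℓ ≠ ℓ)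
      (N : Set ℕ+) (swap : ∀ ℓ, ℓ ∈ N ↔ ι ℓ ∈ Nᶜ)
  | C2 (ι : ℕ+ → ℕ+) (block : IsBlockInvolution ι) (noFix : ∀ ℓ, ι ℓ ≠ ℓ)
      (N : Set ℕ+) (pos : N.Nonempty) (neg : Nᶜ.Nonempty) (stable : ∀ ℓ, ℓ ∈ N ↔ ι ℓ ∈ N)
  | D3 (ι : ℕ+ → ℕ+) (block : IsBlockInvolution ι)
      (N : Set ℕ+) (swap : ∀ ℓ, ℓ ∈ N ↔ ι ℓ ∈ Nᶜ)

namespace Datum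

variable {V : Type*} [AddCommGroup V] [Module ℂ V]

/-- The classical ind-group `𝐆`. -/
noncomputable def G (D : Datum) (E : Module.Basis ℕ+ ℂ V) : Subgroup (V ≃ₗ[ℂ] V) :=
  match D with
  | A1 _ _ => GLinf E
  | A2 _ _ _ => GLinf E
  | A3 _ _ _ => GLinf E
  | BD1 ι _ _ _ _ _ => Ginf E 1 ι
  | C1 ι _ _ _ _ => Ginf E (-1) ι
  | C2 ι _ _ _ _ _ _ => Ginf E (-1) ι
  | D3 ι _ _ _ => Ginf E 1 ι

/-- The symmetric ind-subgroup `𝐊 ⊆ 𝐆`. -/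
noncomputable def K (D : Datum) (E : Module.Basis ℕ+ ℂ V) : Subgroup (V ≃ₗ[ℂ] V) :=
  match D with
  | A1 ι _ => Ginf E 1 ι
  | A2 ι _ _ => Ginf E (-1) ι
  | A3 N _ _ => GLinf E ⊓ commuting (deltaMap E N)
  | BD1 ι _ N _ _ _ => Ginf E 1 ι ⊓ commuting (deltaMap E N)
  | C1 ι _ _ N _ => Ginf E (-1) ι ⊓ commuting (deltaMap E N)
  | C2 ι _ _ N _ _ _ => Ginf E (-1) ι ⊓ commuting (deltaMap E N)
  | D3 ι _ N _ => Ginf E 1 ι ⊓ commuting (deltaMap E N)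

/-- The real form `𝐆⁰ ⊆ 𝐆`. -/
noncomputable def G0 (D : Datum) (E : Module.Basis ℕ+ ℂ V) : Subgroup (V ≃ₗ[ℂ] V) :=
  match D with
  | A1 ι _ => GLinf E ⊓ commuting (gammaMap E 1 ι)
  | A2 ι _ _ => GLinf E ⊓ commuting (gammaMap E (-1) ι)
  | A3 N _ _ => GLinf E ⊓ preserving (phiForm E N)
  | BD1 ι _ N _ _ _ => Ginf E 1 ι ⊓ preserving (phiForm E N)
  | C1 ι _ _ N _ => Ginf E (-1) ι ⊓ preserving (phiForm E N)
  | C2 ι _ _ N _ _ _ => Ginf E (-1) ι ⊓ preserving (phiForm E N)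
  | D3 ι _ N _ => Ginf E 1 ι ⊓ preserving (phiForm E N)

/-- The isotropy condition on flags: none in type A, `ω`-isotropic in types B, C, D. -/
def IsotropyCondition (D : Datum) (E : Module.Basis ℕ+ ℂ V) (𝓕 : Set (Submodule ℂ V)) : Prop :=
  match D with
  | A1 _ _ => True
  | A2 _ _ _ => True
  | A3 _ _ _ => True
  | BD1 ι _ _ _ _ _ => IsIsotropicFlag (omegaForm E 1 ι) 𝓕
  | C1 ι _ _ _ _ => IsIsotropicFlag (omegaForm E (-1) ι) 𝓕
  | C2 ι _ _ _ _ _ _ => IsIsotropicFlag (omegaForm E (-1) ι) 𝓕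
  | D3 ι _ _ _ => IsIsotropicFlag (omegaForm E 1 ι) 𝓕

end Datum

end IndFlag

/-! In every type, one of `𝐊`, `𝐆⁰` consists of the elements of `𝐆` commuting with a map `f`
(`f = γ` or `f = δ`) and the other of those preserving the form `⟨f x, y⟩`, where `⟨x, y⟩ = ᵗx̄ y`.
Suppose that `g ∈ 𝐆` is unitary and `f (g e_k) ∈ ℂ g e_j`. An element of `𝐆` stabilizing `𝓕` is
finitary, hence fixes every member of `𝓕`, and so is triangular with nonzero diagonal in the basis
`E` ordered by `𝓕`. Comparing matrix coefficients, `j` depends only on `k` and on the orbit of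
`g 𝓕`, for either group. Reflections and products of two commuting reflections provide infinitely
many `g` that are pairwise distinguished by some `k`. -/

namespace IndFlag

open ComplexConjugate

section Steps

variable {V : Type*} [AddCommGroup V] [Module ℂ V] {𝓕 : Set (Submodule ℂ V)}
  {F H L M N : Submodule ℂ V}

theorem IsSucc.le_of_lt (h : IsSucc 𝓕 F M) (hc : IsChain (· ≤ ·) 𝓕) (hL : L ∈ 𝓕) (hFL : F < L) :
    M ≤ L :=
  (hc.total h.2.1 hL).elim id fun hLM =>
    (eq_or_lt_of_le hLM).elim Eq.ge fun hLM' => absurd ⟨hFL, hLM'⟩ (h.2.2.2 L hL)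

theorem IsSucc.eq_of_mem_of_notMem (h : IsSucc 𝓕 F M) (h' : IsSucc 𝓕 L N)
    (hc : IsChain (· ≤ ·) 𝓕) {v : V} (hM : v ∈ M) (hF : v ∉ F) (hN : v ∈ N) (hL : v ∉ L) :
    F = L := by
  by_contra hne
  rcases hc.total h.1 h'.1 with hle | hle
  · exact hL (h.le_of_lt hc h'.1 (lt_of_le_of_ne hle hne) hM)
  · exact hF (h'.le_of_lt hc h.1 (lt_of_le_of_ne hle (Ne.symm hne)) hN)

theorem IsSucc.eq_of_between (h : IsSucc 𝓕 F M) (h' : IsSucc 𝓕 L N) (hc : IsChain (· ≤ ·) 𝓕)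
    (hFH : F < H) (hHM : H < M) (hLH : L < H) (hHN : H < N) : F = L ∧ M = N := by
  refine ⟨?_, (h.le_of_lt hc h'.2.1 (hFH.trans hHN)).antisymm
    (h'.le_of_lt hc h.2.1 (hLH.trans hHM))⟩
  by_contra hne
  rcases hc.total h.1 h'.1 with hle | hle
  · exact (h.le_of_lt hc h'.1 (lt_of_le_of_ne hle hne)).not_gt (hLH.trans hHM)
  · exact (h'.le_of_lt hc h.1 (lt_of_le_of_ne hle (Ne.symm hne))).not_gt (hFH.trans hHN)

theorem IsSucc.insert_of_not_between (h : IsSucc 𝓕 F M) (hH : ¬(F < H ∧ H < M)) :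
    IsSucc (insert H 𝓕) F M := by
  refine ⟨Set.mem_insert_of_mem _ h.1, Set.mem_insert_of_mem _ h.2.1, h.2.2.1, ?_⟩
  rintro L (rfl | hL)
  exacts [hH, h.2.2.2 L hL]

theorem IsSucc.insert_left (h : IsSucc 𝓕 F M) (hFH : F < H) (hHM : H < M) :
    IsSucc (insert H 𝓕) F H := by
  refine ⟨Set.mem_insert_of_mem _ h.1, Set.mem_insert _ _, hFH, ?_⟩
  rintro L (rfl | hL) ⟨hFL, hLH⟩
  exacts [hLH.false, h.2.2.2 L hL ⟨hFL, hLH.trans hHM⟩]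

theorem IsSucc.insert_right (h : IsSucc 𝓕 F M) (hFH : F < H) (hHM : H < M) :
    IsSucc (insert H 𝓕) H M := by
  refine ⟨Set.mem_insert _ _, Set.mem_insert_of_mem _ h.2.1, hHM, ?_⟩
  rintro L (rfl | hL) ⟨hHL, hLM⟩
  exacts [hHL.false, h.2.2.2 L hL ⟨hFH.trans hHL, hLM⟩]

theorem IsSucc.isChain_insert (h : IsSucc 𝓕 F M) (hc : IsChain (· ≤ ·) 𝓕) (hFH : F < H)
    (hHM : H < M) : IsChain (· ≤ ·) (insert H 𝓕) := by
  refine hc.insert fun L hL _ => ?_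
  rcases hc.total hL h.1 with hLF | hFL
  · exact Or.inr (hLF.trans hFH.le)
  rcases hFL.eq_or_lt with rfl | hFL
  · exact Or.inr hFH.le
  · exact Or.inl (hHM.le.trans (h.le_of_lt hc hL hFL))

theorem IsGeneralizedFlag.insert_between (h𝓕 : IsGeneralizedFlag 𝓕) (h : IsSucc 𝓕 F M) (hFH : F < H)
    (hHM : H < M) : IsGeneralizedFlag (insert H 𝓕) := by
  have hc := h.isChain_insert h𝓕.chain hFH hHM
  have split {L N} (h' : IsSucc 𝓕 L N) : IsSucc (insert H 𝓕) L N ∨ F = L ∧ M = N := by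
    by_cases hH : L < H ∧ H < N
    · exact Or.inr (h.eq_of_between h' h𝓕.chain hFH hHM hH.1 hH.2)
    · exact Or.inl (h'.insert_of_not_between hH)
  refine ⟨hc, ?_, fun v hv => ?_⟩
  · rintro L (rfl | hL)
    · exact Or.inl ⟨M, h.insert_right hFH hHM⟩
    rcases h𝓕.succ_or_pred L hL with ⟨N, hN⟩ | ⟨N, hN⟩
    · rcases split hN with hN | ⟨rfl, -⟩
      exacts [Or.inl ⟨N, hN⟩, Or.inl ⟨H, h.insert_left hFH hHM⟩]
    · rcases split hN with hN | ⟨-, rfl⟩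
      exacts [Or.inr ⟨N, hN⟩, Or.inr ⟨H, h.insert_right hFH hHM⟩]
  · obtain ⟨L, ⟨N, hLN, hvN, hvL⟩, -⟩ := h𝓕.unique_step v hv
    suffices ∃ L N, IsSucc (insert H 𝓕) L N ∧ v ∈ N ∧ v ∉ L by
      obtain ⟨L, N, hLN, hvN, hvL⟩ := this
      refine ⟨L, ⟨N, hLN, hvN, hvL⟩, ?_⟩
      rintro L' ⟨N', hLN', hvN', hvL'⟩
      exact hLN'.eq_of_mem_of_notMem hLN hc hvN' hvL' hvN hvL
    rcases split hLN with hLN | ⟨rfl, rfl⟩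
    · exact ⟨L, N, hLN, hvN, hvL⟩
    by_cases hvH : v ∈ H
    · exact ⟨F, H, h.insert_left hFH hHM, hvH, hvL⟩
    · exact ⟨H, M, h.insert_right hFH hHM, hvN, hvH⟩

theorem IsMaximalGeneralizedFlag.not_between (h𝓕 : IsMaximalGeneralizedFlag 𝓕)
    (h : IsSucc 𝓕 F M) : ¬(F < H ∧ H < M) := fun ⟨hFH, hHM⟩ =>
  h.2.2.2 H (h𝓕.2 _ (h𝓕.1.insert_between h hFH hHM) (Set.subset_insert H 𝓕) ▸ Set.mem_insert H 𝓕)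
    ⟨hFH, hHM⟩

end Steps

section CompatibleFlags

theorem span_image_lt_span_image_iff {ι R M : Type*} [Semiring R] [Nontrivial R]
    [AddCommMonoid M] [Module R M] (b : Module.Basis ι R M) {s t : Set ι} :
    Submodule.span R (b '' s) < Submodule.span R (b '' t) ↔ s ⊂ t := by
  have hle {s t : Set ι} : Submodule.span R (b '' s) ≤ Submodule.span R (b '' t) ↔ s ⊆ t :=
    ⟨fun h i hi => b.self_mem_span_image.1 (h (Submodule.subset_span ⟨i, hi, rfl⟩)),
      fun h => Submodule.span_mono (Set.image_mono h)⟩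
  rw [lt_iff_le_not_ge, hle, hle, ssubset_iff_subset_not_subset]

variable {V : Type*} [AddCommGroup V] [Module ℂ V] {A : Type} [LinearOrder A] {σ : ℕ+ → A}

theorem isSucc_flagOf (E : Module.Basis ℕ+ ℂ V) (p : ℕ+) :
    IsSucc (flagOf σ E) (Submodule.span ℂ (E '' {ℓ | σ ℓ < σ p}))
      (Submodule.span ℂ (E '' {ℓ | σ ℓ ≤ σ p})) := by
  refine ⟨⟨σ p, Or.inl rfl⟩, ⟨σ p, Or.inr rfl⟩, ?_, ?_⟩
  · rw [span_image_lt_span_image_iff]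
    exact ⟨fun ℓ hℓ => le_of_lt hℓ, fun h => lt_irrefl (σ p) (h (le_refl (σ p)))⟩
  · rintro L ⟨a, rfl | rfl⟩ ⟨hL, hL'⟩ <;> rw [span_image_lt_span_image_iff] at hL hL' <;>
      obtain ⟨ℓ, hℓ, hℓp⟩ := Set.exists_of_ssubset hL <;>
      refine hL'.2 fun m hm => ?_
    · exact (hm.trans (not_lt.1 hℓp)).trans_lt hℓ
    · exact (hm.trans (not_lt.1 hℓp)).trans hℓ

theorem injective_of_isMaximal {E : Module.Basis ℕ+ ℂ V}
    (h : IsMaximalGeneralizedFlag (flagOf σ E)) : Function.Injective σ := by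
  intro p q hpq
  by_contra hne
  refine h.not_between (isSucc_flagOf E p)
    (H := Submodule.span ℂ (E '' insert p {ℓ | σ ℓ < σ p})) ?_
  simp only [span_image_lt_span_image_iff]
  constructor
  · exact Set.ssubset_insert (lt_irrefl (σ p))
  · refine (Set.ssubset_iff_of_subset ?_).2 ⟨q, hpq.ge, ?_⟩
    · exact Set.insert_subset (le_refl (σ p)) fun ℓ hℓ => le_of_lt hℓ
    · simp [Ne.symm hne, hpq]

end CompatibleFlags

section Stabilizers

theorem map_eq_of_map_le_of_finiteDimensional_range {K V : Type*} [DivisionRing K]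
    [AddCommGroup V] [Module K V] {u : V ≃ₗ[K] V} {F : Submodule K V}
    (hu : FiniteDimensional K (LinearMap.range ((u : V →ₗ[K] V) - LinearMap.id)))
    (h : F.map (u : V →ₗ[K] V) ≤ F) : F.map (u : V →ₗ[K] V) = F := by
  refine le_antisymm h fun x hx => ?_
  set R := LinearMap.range ((u : V →ₗ[K] V) - LinearMap.id)
  set W := F ⊓ (Submodule.span K {x} ⊔ R)
  have hfin : FiniteDimensional K W := Submodule.finiteDimensional_inf_right _ _
  have hW : W.map (u : V →ₗ[K] V) ≤ W := by
    rintro _ ⟨y, hy, rfl⟩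
    refine ⟨h ⟨y, hy.1, rfl⟩, ?_⟩
    have hyR : u y - y ∈ R := ⟨y, rfl⟩
    simpa using add_mem hy.2 (Submodule.mem_sup_right (S := Submodule.span K {x}) hyR)
  have hWeq := Submodule.eq_of_le_of_finrank_eq hW (LinearEquiv.finrank_map_eq u W)
  have hxW : x ∈ W := ⟨hx, Submodule.mem_sup_left (Submodule.mem_span_singleton_self x)⟩
  rw [← hWeq] at hxW
  exact Submodule.map_mono inf_le_left hxW

variable {V : Type*} [AddCommGroup V] [Module ℂ V] {E : Module.Basis ℕ+ ℂ V}

theorem finiteDimensional_range_of_mem_GLinf {u : V ≃ₗ[ℂ] V} (hu : u ∈ GLinf E) :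
    FiniteDimensional ℂ (LinearMap.range ((u : V →ₗ[ℂ] V) - LinearMap.id)) := by
  obtain ⟨n, hn⟩ := Filter.eventually_atTop.1 hu
  rw [LinearMap.range_eq_map, ← E.span_eq, Submodule.map_span, ← Set.range_comp]
  refine FiniteDimensional.span_of_finite ℂ
    (((Set.finite_Iio n).image fun ℓ => u (E ℓ) - E ℓ).insert 0 |>.subset ?_)
  rintro _ ⟨ℓ, rfl⟩
  rcases lt_or_ge ℓ n with hℓ | hℓ
  · exact Or.inr ⟨ℓ, hℓ, rfl⟩
  · exact Or.inl (by simp [hn ℓ hℓ])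

/-- A finitary automorphism cannot move a member of the chain strictly up or down. -/
theorem GLinf_inf_flagStabilizer_le_fixingSubgroup {𝓕 : Set (Submodule ℂ V)}
    (hc : IsChain (· ≤ ·) 𝓕) :
    GLinf E ⊓ flagStabilizer 𝓕 ≤ fixingSubgroup (V ≃ₗ[ℂ] V) 𝓕 := by
  have key {u : V ≃ₗ[ℂ] V} (hu : u ∈ GLinf E) {F : Submodule ℂ V} (h : u • F ≤ F) : u • F = F :=
    map_eq_of_map_le_of_finiteDimensional_range (finiteDimensional_range_of_mem_GLinf hu) h
  rintro u ⟨hu, hst⟩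
  refine (mem_fixingSubgroup_iff _).2 fun F hF => ?_
  have huF : u • F ∈ 𝓕 := (MulAction.mem_stabilizer_iff.1 hst).subset (Set.smul_mem_smul_set hF)
  rcases hc.total huF hF with h | h
  · exact key hu h
  · have hinv : u⁻¹ • F ≤ u⁻¹ • u • F := Submodule.map_mono h
    exact (inv_smul_eq_iff.1 (key (inv_mem hu) (hinv.trans_eq (inv_smul_smul u F)))).symm

variable {A : Type} [LinearOrder A] {σ : ℕ+ → A} {u : V ≃ₗ[ℂ] V}

theorem apply_mem_iff_of_mem_fixingSubgroup {𝓕 : Set (Submodule ℂ V)}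
    (hu : u ∈ fixingSubgroup (V ≃ₗ[ℂ] V) 𝓕) {F : Submodule ℂ V} (hF : F ∈ 𝓕) {x : V} :
    u x ∈ F ↔ x ∈ F := by
  have h : F.map (u : V →ₗ[ℂ] V) = F := (mem_fixingSubgroup_iff _).1 hu F hF
  conv_lhs => rw [← h]
  simp

theorem le_of_repr_apply_ne_zero (hu : u ∈ fixingSubgroup (V ≃ₗ[ℂ] V) (flagOf σ E)) {ℓ m : ℕ+}
    (h : E.repr (u (E m)) ℓ ≠ 0) : σ ℓ ≤ σ m := by
  have hm : u (E m) ∈ Submodule.span ℂ (E '' {ℓ | σ ℓ ≤ σ m}) :=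
    (apply_mem_iff_of_mem_fixingSubgroup hu ⟨σ m, Or.inr rfl⟩).2 (by simp)
  exact E.mem_span_image.1 hm (Finsupp.mem_support_iff.2 h)

theorem repr_apply_self_ne_zero (hσ : Function.Injective σ)
    (hu : u ∈ fixingSubgroup (V ≃ₗ[ℂ] V) (flagOf σ E)) (m : ℕ+) : E.repr (u (E m)) m ≠ 0 := by
  intro h0
  have hm : u (E m) ∈ Submodule.span ℂ (E '' {ℓ | σ ℓ < σ m}) := by
    refine E.mem_span_image.2 fun ℓ hℓ => ?_
    have hℓ' := Finsupp.mem_support_iff.1 hℓ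
    refine lt_of_le_of_ne (le_of_repr_apply_ne_zero hu hℓ') fun h => hℓ' ?_
    rwa [hσ h]
  rw [apply_mem_iff_of_mem_fixingSubgroup hu ⟨σ m, Or.inl rfl⟩] at hm
  simp at hm

end Stabilizers

section Hermitian

variable {V : Type*} [AddCommGroup V] [Module ℂ V] {I : Type*} (E : Module.Basis I ℂ V)

/-- The Hermitian product for which the basis `E` is orthonormal, antilinear in the first
variable. -/
noncomputable def herm : V →ₗ⋆[ℂ] V →ₗ[ℂ] ℂ :=
  LinearMap.mk₂'ₛₗ (starRingEnd ℂ) (RingHom.id ℂ)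
    (fun x y => (E.repr x).sum fun ℓ a => conj a * E.repr y ℓ)
    (fun x x' y => by
      rw [map_add, Finsupp.sum_add_index'] <;> simp [add_mul])
    (fun a x y => by
      rw [map_smul, Finsupp.sum_smul_index' (by simp), smul_eq_mul, Finsupp.mul_sum]
      simp [mul_assoc])
    (fun x y y' => by
      simp [mul_add])
    (fun a x y => by
      rw [RingHom.id_apply, smul_eq_mul, Finsupp.mul_sum]
      simp [mul_left_comm])

theorem herm_apply (x y : V) : herm E x y = (E.repr x).sum fun ℓ a => conj a * E.repr y ℓ := rfl

@[simp]
theorem herm_basis_left (ℓ : I) (y : V) : herm E (E ℓ) y = E.repr y ℓ := by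
  simp [herm_apply]

theorem conj_herm (x y : V) : conj (herm E x y) = herm E y x := by
  classical
  rw [herm_apply, herm_apply,
    Finsupp.sum_of_support_subset _ (Finset.subset_union_left (s₂ := (E.repr y).support)) _
      (by simp),
    Finsupp.sum_of_support_subset _ (Finset.subset_union_right (s₁ := (E.repr x).support)) _
      (by simp)]
  simp [mul_comm]

@[simp]
theorem herm_basis_right (x : V) (ℓ : I) : herm E x (E ℓ) = conj (E.repr x ℓ) := by
  rw [← conj_herm, herm_basis_left]

theorem herm_ne_zero_symm {x y : V} (h : herm E x y ≠ 0) : herm E y x ≠ 0 := by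
  rwa [← conj_herm, map_ne_zero]

/-- The automorphisms preserving the Hermitian product for which `E` is orthonormal. -/
noncomputable def unitaryGroup : Subgroup (V ≃ₗ[ℂ] V) := preserving fun x y => herm E x y

variable {E}

theorem herm_apply_apply {g : V ≃ₗ[ℂ] V} (hg : g ∈ unitaryGroup E) (x y : V) :
    herm E (g x) (g y) = herm E x y := hg x y

theorem repr_inv_apply {g : V ≃ₗ[ℂ] V} (hg : g ∈ unitaryGroup E) (ℓ : I) (x : V) :
    E.repr (g⁻¹ x) ℓ = herm E (g (E ℓ)) x := by
  rw [← herm_basis_left, ← herm_apply_apply hg, ← LinearEquiv.mul_apply, mul_inv_cancel,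
    LinearEquiv.coe_one, id]

theorem herm_smul_self (a : ℂ) (x : V) :
    herm E (a • x) (a • x) = Complex.normSq a * herm E x x := by
  rw [map_smul, LinearMap.map_smulₛₗ₂, smul_smul, Complex.mul_conj, smul_eq_mul]

theorem herm_sqrt_two_smul_basis (p : I) :
    herm E ((√2 : ℂ) • E p) ((√2 : ℂ) • E p) = 2 := by
  rw [herm_smul_self]
  simp [Complex.normSq_ofReal]

end Hermitian

section Separation

variable {V : Type*} [AddCommGroup V] [Module ℂ V]

theorem infinite_orbitSet {G H : Subgroup (V ≃ₗ[ℂ] V)} {𝓕 : Set (Submodule ℂ V)} {ι : Type*}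
    {S : Set ι} (hS : S.Infinite) {g : ι → V ≃ₗ[ℂ] V} (hg : ∀ n ∈ S, g n ∈ G)
    (hsep : S.Pairwise fun m n => ∀ h ∈ H, (g n)⁻¹ * h * g m ∉ flagStabilizer 𝓕) :
    Infinite (OrbitSet G H 𝓕) := by
  have := hS.to_subtype
  refine Infinite.of_injective (fun n : S => (Quotient.mk'' (QuotientGroup.mk ⟨g n, hg n n.2⟩) :
    OrbitSet G H 𝓕)) fun m n hmn => ?_
  by_contra hne
  obtain ⟨h, hh⟩ := MulAction.orbitRel_apply.1 (Quotient.eq''.1 hmn.symm)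
  have hst := Subgroup.mem_subgroupOf.1 (QuotientGroup.eq.1 hh.symm)
  refine hsep m.2 n.2 (fun e => hne (Subtype.ext e)) _ (Subgroup.mem_subgroupOf.1 h.2) ?_
  simpa [mul_assoc] using hst

/-- `f` carries the line `ℂ g e_k` into the line `ℂ g e_j`. With `f` the map defining a symmetric
pair, this records the position of the flag `g 𝓕` relative to its image under `f`. -/
def CarriesLine {I : Type*} (E : Module.Basis I ℂ V) (f : V → V) (g : V ≃ₗ[ℂ] V) (k j : I) : Prop :=
  ∃ c : ℂ, f (g (E k)) = c • g (E j)

variable {A : Type} [LinearOrder A] {σ : ℕ+ → A} {E : Module.Basis ℕ+ ℂ V}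
  {f : V → V} {g₁ g₂ h : V ≃ₗ[ℂ] V} {k j₁ j₂ : ℕ+}

theorem CarriesLine.mul {g h : V ≃ₗ[ℂ] V} {j : ℕ+} (hg : CarriesLine E f g k j)
    (hk : h (E k) = E k) (hj : h (E j) = E j) : CarriesLine E f (g * h) k j := by
  rwa [CarriesLine, LinearEquiv.mul_apply, LinearEquiv.mul_apply, hk, hj]

theorem herm_apply_basis_ne_zero (hσ : Function.Injective σ) (hg₂ : g₂ ∈ unitaryGroup E)
    (hfix : g₂⁻¹ * h * g₁ ∈ fixingSubgroup (V ≃ₗ[ℂ] V) (flagOf σ E)) (k : ℕ+) :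
    herm E (g₂ (E k)) (h (g₁ (E k))) ≠ 0 := by
  rw [← repr_inv_apply hg₂]
  exact repr_apply_self_ne_zero hσ hfix k

theorem le_of_herm_apply_basis_ne_zero (hg₂ : g₂ ∈ unitaryGroup E)
    (hfix : g₂⁻¹ * h * g₁ ∈ fixingSubgroup (V ≃ₗ[ℂ] V) (flagOf σ E))
    (hne : herm E (g₂ (E j₂)) (h (g₁ (E j₁))) ≠ 0) : σ j₂ ≤ σ j₁ := by
  rw [← repr_inv_apply hg₂] at hne
  exact le_of_repr_apply_ne_zero hfix hne

theorem inv_mul_mul_mem_fixingSubgroup {𝓕 : Set (Submodule ℂ V)}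
    (hfix : g₂⁻¹ * h * g₁ ∈ fixingSubgroup (V ≃ₗ[ℂ] V) 𝓕) :
    g₁⁻¹ * h⁻¹ * g₂ ∈ fixingSubgroup (V ≃ₗ[ℂ] V) 𝓕 := by
  simpa [mul_assoc] using inv_mem hfix

theorem CarriesLine.le_of_commuting (h₁ : CarriesLine E f g₁ k j₁) (h₂ : CarriesLine E f g₂ k j₂)
    (hσ : Function.Injective σ) (hf : ∀ x y, herm E x y ≠ 0 → herm E (f x) (f y) ≠ 0)
    (hg₂ : g₂ ∈ unitaryGroup E) (hh : h ∈ commuting f)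
    (hfix : g₂⁻¹ * h * g₁ ∈ fixingSubgroup (V ≃ₗ[ℂ] V) (flagOf σ E)) : σ j₂ ≤ σ j₁ := by
  obtain ⟨c₁, hc₁⟩ := h₁
  obtain ⟨c₂, hc₂⟩ := h₂
  have hne := hf _ _ (herm_apply_basis_ne_zero hσ hg₂ hfix k)
  rw [hh, hc₁, hc₂, LinearMap.map_smulₛₗ₂, map_smul, map_smul] at hne
  refine le_of_herm_apply_basis_ne_zero hg₂ hfix fun h0 => hne ?_
  rw [h0, smul_zero, smul_zero]

theorem CarriesLine.le_of_preserving (h₁ : CarriesLine E f g₁ k j₁)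
    (h₂ : CarriesLine E f g₂ k j₂) (hσ : Function.Injective σ)
    (hf : ∀ x y, herm E x y ≠ 0 → herm E (f x) (f y) ≠ 0) (hg₁ : g₁ ∈ unitaryGroup E)
    (hg₂ : g₂ ∈ unitaryGroup E) (hh : h ∈ preserving fun x y => herm E (f x) y)
    (hfix : g₂⁻¹ * h * g₁ ∈ fixingSubgroup (V ≃ₗ[ℂ] V) (flagOf σ E)) : σ j₁ ≤ σ j₂ := by
  obtain ⟨c₁, hc₁⟩ := h₁
  obtain ⟨c₂, hc₂⟩ := h₂
  have hne := hf _ _ (herm_ne_zero_symm E (herm_apply_basis_ne_zero hσ hg₂ hfix k))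
  have hmove : herm E (f (h (g₁ (E k)))) (g₂ (E j₂)) =
      herm E (f (g₁ (E k))) (h⁻¹ (g₂ (E j₂))) := by
    simpa using hh (g₁ (E k)) (h⁻¹ (g₂ (E j₂)))
  rw [hc₂, map_smul, hmove, hc₁, LinearMap.map_smulₛₗ₂] at hne
  refine le_of_herm_apply_basis_ne_zero hg₁ (inv_mul_mul_mem_fixingSubgroup hfix)
    fun h0 => hne ?_
  rw [h0, smul_zero, smul_zero]

theorem CarriesLine.eq_of_commuting (h₁ : CarriesLine E f g₁ k j₁) (h₂ : CarriesLine E f g₂ k j₂)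
    (hσ : Function.Injective σ) (hf : ∀ x y, herm E x y ≠ 0 → herm E (f x) (f y) ≠ 0)
    (hg₁ : g₁ ∈ unitaryGroup E) (hg₂ : g₂ ∈ unitaryGroup E) (hh : h ∈ commuting f)
    (hfix : g₂⁻¹ * h * g₁ ∈ fixingSubgroup (V ≃ₗ[ℂ] V) (flagOf σ E)) : j₁ = j₂ :=
  hσ ((h₂.le_of_commuting h₁ hσ hf hg₁ (inv_mem hh)
    (inv_mul_mul_mem_fixingSubgroup hfix)).antisymm (h₁.le_of_commuting h₂ hσ hf hg₂ hh hfix))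

theorem CarriesLine.eq_of_preserving (h₁ : CarriesLine E f g₁ k j₁)
    (h₂ : CarriesLine E f g₂ k j₂) (hσ : Function.Injective σ)
    (hf : ∀ x y, herm E x y ≠ 0 → herm E (f x) (f y) ≠ 0) (hg₁ : g₁ ∈ unitaryGroup E)
    (hg₂ : g₂ ∈ unitaryGroup E) (hh : h ∈ preserving fun x y => herm E (f x) y)
    (hfix : g₂⁻¹ * h * g₁ ∈ fixingSubgroup (V ≃ₗ[ℂ] V) (flagOf σ E)) : j₁ = j₂ :=
  hσ ((h₁.le_of_preserving h₂ hσ hf hg₁ hg₂ hh hfix).antisymm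
    (h₂.le_of_preserving h₁ hσ hf hg₂ hg₁ (inv_mem hh) (inv_mul_mul_mem_fixingSubgroup hfix)))

theorem infinite_orbitSets_of_pairwise {α : Type*} {G H₁ H₂ : Subgroup (V ≃ₗ[ℂ] V)}
    (hmax : IsMaximalGeneralizedFlag (flagOf σ E))
    (hf : ∀ x y, herm E x y ≠ 0 → herm E (f x) (f y) ≠ 0)
    (hG : G ≤ GLinf E) (hH₁G : H₁ ≤ G) (hH₁ : H₁ ≤ commuting f) (hH₂G : H₂ ≤ G)
    (hH₂ : H₂ ≤ preserving fun x y => herm E (f x) y)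
    {S : Set α} (hS : S.Infinite) {g : α → V ≃ₗ[ℂ] V} (hg : ∀ n ∈ S, g n ∈ G ⊓ unitaryGroup E)
    (hsep : S.Pairwise fun m n =>
      ∃ k i j, i ≠ j ∧ CarriesLine E f (g m) k i ∧ CarriesLine E f (g n) k j) :
    Infinite (OrbitSet G H₁ (flagOf σ E)) ∧ Infinite (OrbitSet G H₂ (flagOf σ E)) := by
  have hσ := injective_of_isMaximal hmax
  have hfix {h : V ≃ₗ[ℂ] V} {m n : α} (hm : m ∈ S) (hn : n ∈ S) (hh : h ∈ G)
      (hst : (g n)⁻¹ * h * g m ∈ flagStabilizer (flagOf σ E)) :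
      (g n)⁻¹ * h * g m ∈ fixingSubgroup (V ≃ₗ[ℂ] V) (flagOf σ E) :=
    GLinf_inf_flagStabilizer_le_fixingSubgroup hmax.1.chain
      ⟨hG (mul_mem (mul_mem (inv_mem (hg n hn).1) hh) (hg m hm).1), hst⟩
  constructor <;> refine infinite_orbitSet hS (fun n hn => (hg n hn).1)
    fun m hm n hn hmn h hh hst => ?_ <;> obtain ⟨k, i, j, hij, hi, hj⟩ := hsep hm hn hmn
  · exact hij (hi.eq_of_commuting hj hσ hf (hg m hm).2 (hg n hn).2 (hH₁ hh)
      (hfix hm hn (hH₁G hh) hst))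
  · exact hij (hi.eq_of_preserving hj hσ hf (hg m hm).2 (hg n hn).2 (hH₂ hh)
      (hfix hm hn (hH₂G hh) hst))

end Separation

theorem IsBlockInvolution.involutive {ι : ℕ+ → ℕ+} (h : IsBlockInvolution ι) :
    Function.Involutive ι := fun ℓ => (h ℓ).1

section Gamma

variable {V : Type*} [AddCommGroup V] [Module ℂ V] (E : Module.Basis ℕ+ ℂ V) {c : ℂ}
  {ι : ℕ+ → ℕ+}

/-- The map `γ` as an antilinear map. -/
noncomputable def gammaHom (c : ℂ) (ι : ℕ+ → ℕ+) : V →ₗ⋆[ℂ] V where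
  toFun := gammaMap E c ι
  map_add' x y := by
    rw [gammaMap, map_add, Finsupp.sum_add_index'] <;> simp [gammaMap, mul_add, add_smul]
  map_smul' a x := by
    rw [gammaMap, map_smul, Finsupp.sum_smul_index' (by simp), gammaMap, Finsupp.smul_sum]
    simp [smul_smul, mul_left_comm]

theorem Omega_involution_eq (hc : c = 1 ∨ c = -1) (hι : Function.Involutive ι) (j : ℕ+) :
    Omega c ι (ι j) j = 1 ∨ Omega c ι (ι j) j = -1 := by
  rw [Omega, if_pos (hι j).symm]
  split_ifs
  exacts [Or.inl rfl, hc]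

theorem gammaHom_basis (j : ℕ+) :
    gammaHom E c ι (E j) = Omega c ι (ι j) j • E (ι j) := by
  simp [gammaHom, gammaMap]

theorem gammaHom_one_basis (hι : Function.Involutive ι) (j : ℕ+) :
    gammaHom E 1 ι (E j) = E (ι j) := by
  rw [gammaHom_basis, Omega, if_pos (hι j).symm, ite_self, one_smul]

theorem omegaForm_basis (i j : ℕ+) : omegaForm E c ι (E i) (E j) = Omega c ι i j := by
  simp [omegaForm]

theorem omegaForm_eq_herm_gammaHom (hc : c = 1 ∨ c = -1) (hι : Function.Involutive ι) (x y : V) :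
    omegaForm E c ι y x = herm E (gammaHom E c ι x) y := by
  suffices (omegaForm E c ι).flip = (herm E).comp (gammaHom E c ι) from
    LinearMap.congr_fun₂ this x y
  refine LinearMap.ext_basis E E fun j i => ?_
  rw [LinearMap.flip_apply, omegaForm_basis, LinearMap.comp_apply, gammaHom_basis,
    LinearMap.map_smulₛₗ₂, herm_basis_left, E.repr_self]
  rcases eq_or_ne i (ι j) with rfl | h
  · rcases Omega_involution_eq hc hι j with h | h <;> simp [h]
  · have h' : j ≠ ι i := fun e => h (by rw [e, hι])
    simp [Omega, h, h']

theorem omegaForm_gammaHom_left (hc : c = 1 ∨ c = -1) (hι : Function.Involutive ι) (x y : V) :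
    omegaForm E c ι (gammaHom E c ι x) y = herm E x y := by
  suffices (omegaForm E c ι).comp (gammaHom E c ι) = herm E from LinearMap.congr_fun₂ this x y
  refine LinearMap.ext_basis E E fun j i => ?_
  rw [LinearMap.comp_apply, gammaHom_basis, map_smul, LinearMap.smul_apply, omegaForm_basis,
    herm_basis_left, E.repr_self]
  rcases eq_or_ne i j with rfl | h
  · rcases Omega_involution_eq hc hι i with h | h <;> simp [h]
  · simp [Omega, hι j, h]

theorem herm_gammaHom_gammaHom (hc : c = 1 ∨ c = -1) (hι : Function.Involutive ι) (x y : V) :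
    herm E (gammaHom E c ι x) (gammaHom E c ι y) = herm E y x := by
  rw [← omegaForm_eq_herm_gammaHom E hc hι, omegaForm_gammaHom_left E hc hι]

theorem repr_gammaHom_eq_zero (hc : c = 1 ∨ c = -1) (hι : Function.Involutive ι) {x : V} {ℓ : ℕ+}
    (h : E.repr x (ι ℓ) = 0) : E.repr (gammaHom E c ι x) ℓ = 0 := by
  have hγ := herm_gammaHom_gammaHom E hc hι (E (ι ℓ)) x
  rw [gammaHom_basis, hι, LinearMap.map_smulₛₗ₂, herm_basis_left, herm_basis_right, h,
    map_zero, smul_eq_mul, mul_eq_zero] at hγ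
  refine hγ.resolve_left ?_
  have hΩ := Omega_involution_eq hc hι (ι ℓ)
  rw [hι] at hΩ
  rcases hΩ with hΩ | hΩ <;> simp [hΩ]

theorem herm_gammaHom_self_eq_zero (hc : c = 1 ∨ c = -1) (hι : Function.Involutive ι) {x : V}
    (h : ∀ ℓ, E.repr x ℓ ≠ 0 → E.repr x (ι ℓ) = 0) : herm E x (gammaHom E c ι x) = 0 := by
  rw [herm_apply]
  exact Finset.sum_eq_zero fun ℓ hℓ => mul_eq_zero_of_right _
    (repr_gammaHom_eq_zero E hc hι (h ℓ (Finsupp.mem_support_iff.1 hℓ)))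

theorem gammaHom_gammaHom (hι : Function.Involutive ι) (hfix : ∀ ℓ, ι ℓ ≠ ℓ) (hc : c = 1 ∨ c = -1)
    (x : V) : gammaHom E c ι (gammaHom E c ι x) = c • x := by
  suffices (gammaHom E c ι).comp (gammaHom E c ι) = c • LinearMap.id from
    LinearMap.congr_fun this x
  refine E.ext fun j => ?_
  rw [LinearMap.comp_apply, gammaHom_basis, map_smulₛₗ, gammaHom_basis, hι, smul_smul,
    LinearMap.smul_apply, LinearMap.id_apply]
  congr 1
  rcases lt_or_gt_of_ne (hfix j) with h | h <;> rcases hc with rfl | rfl <;>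
    simp [Omega, hι j, h.le, h.not_ge]

theorem Ginf_le_preserving_gammaHom (hc : c = 1 ∨ c = -1) (hι : Function.Involutive ι) :
    Ginf E c ι ≤ preserving fun x y => herm E (gammaHom E c ι x) y := by
  rintro g ⟨-, hg⟩ x y
  simpa only [omegaForm_eq_herm_gammaHom E hc hι] using hg y x

end Gamma

section Delta

variable {V : Type*} [AddCommGroup V] [Module ℂ V] (E : Module.Basis ℕ+ ℂ V) (N : Set ℕ+)

theorem sgn_eq (ℓ : ℕ+) : sgn N ℓ = 1 ∨ sgn N ℓ = -1 := by
  unfold sgn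
  split_ifs <;> simp

theorem exists_infinite_setOf_sgn_eq_neg {N : Set ℕ+} (pos : N.Nonempty)
    (neg : Nᶜ.Nonempty) : ∃ p, {i | sgn N i = -sgn N p}.Infinite := by
  obtain ⟨q, hq⟩ := pos
  obtain ⟨r, hr⟩ := neg
  rcases Set.infinite_union.1 (N.union_compl_self.symm ▸ Set.infinite_univ) with h | h
  · refine ⟨r, h.mono fun i hi => ?_⟩
    simp [sgn, hi, Set.notMem_of_mem_compl hr]
  · refine ⟨q, h.mono fun i hi => ?_⟩
    simp [sgn, hq, Set.notMem_of_mem_compl hi]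

theorem sgn_ne_zero (ℓ : ℕ+) : sgn N ℓ ≠ 0 := by
  rcases sgn_eq N ℓ with h | h <;> simp [h]

theorem sgn_apply_of_mem_iff {N : Set ℕ+} {ι : ℕ+ → ℕ+} (stable : ∀ ℓ, ℓ ∈ N ↔ ι ℓ ∈ N) (ℓ : ℕ+) :
    sgn N (ι ℓ) = sgn N ℓ := by
  classical exact if_congr (stable ℓ).symm rfl rfl

theorem conj_sgn (ℓ : ℕ+) : conj (sgn N ℓ) = sgn N ℓ := by
  rcases sgn_eq N ℓ with h | h <;> simp [h]

theorem deltaMap_basis (ℓ : ℕ+) : deltaMap E N (E ℓ) = sgn N ℓ • E ℓ := by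
  simp [deltaMap]

theorem repr_deltaMap (x : V) (ℓ : ℕ+) : E.repr (deltaMap E N x) ℓ = sgn N ℓ * E.repr x ℓ := by
  suffices E.coord ℓ ∘ₗ deltaMap E N = sgn N ℓ • E.coord ℓ from LinearMap.congr_fun this x
  refine E.ext fun j => ?_
  rcases eq_or_ne j ℓ with rfl | h <;> simp [deltaMap_basis, *]

theorem herm_deltaMap_left (x y : V) : herm E (deltaMap E N x) y = phiForm E N x y := by
  rw [herm_apply, Finsupp.sum_of_support_subset _ (s := (E.repr x).support) _ _ (by simp)]
  · simp [phiForm, Finsupp.sum, repr_deltaMap, conj_sgn, mul_comm]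
  · intro ℓ
    simp [repr_deltaMap]

theorem herm_deltaMap_deltaMap (x y : V) :
    herm E (deltaMap E N x) (deltaMap E N y) = herm E x y := by
  suffices ((herm E).comp (deltaMap E N)).compl₂ (deltaMap E N) = herm E from
    LinearMap.congr_fun₂ this x y
  refine LinearMap.ext_basis E E fun i j => ?_
  rcases eq_or_ne i j with rfl | hij
  · rcases sgn_eq N i with h | h <;> simp [deltaMap_basis, h]
  · simp [deltaMap_basis, hij]

theorem deltaMap_smul_basis (a : ℂ) (p : ℕ+) :
    deltaMap E N (a • E p) = sgn N p • a • E p := by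
  rw [map_smul, deltaMap_basis, smul_comm]

variable {E N}

theorem repr_eq_zero_of_deltaMap_eq_smul {p i : ℕ+} {z : V} (hz : deltaMap E N z = sgn N p • z)
    (hi : sgn N i = -sgn N p) : E.repr z i = 0 := by
  have h := repr_deltaMap E N z i
  rw [hz, hi, map_smul, Finsupp.smul_apply, smul_eq_mul] at h
  exact self_eq_neg.1 (mul_left_cancel₀ (sgn_ne_zero N p) (h.trans (neg_mul_comm _ _)))

end Delta

section Reflections

variable {V : Type*} [AddCommGroup V] [Module ℂ V] {I : Type*} (E : Module.Basis I ℂ V) {u v x : V}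

/-- The orthogonal reflection in the hyperplane `u^⊥` for the Hermitian product `herm E`. For
`u = 0` the convention `2 / 0 = 0` makes it the identity. -/
noncomputable def reflection (u : V) : V ≃ₗ[ℂ] V :=
  LinearEquiv.ofInvolutive (LinearMap.id - ((2 / herm E u u) • herm E u).smulRight u) fun x => by
    by_cases hu : herm E u u = 0
    · simp [hu]
    · have h : 2 / herm E u u * herm E u u = 2 := div_mul_cancel₀ 2 hu
      simp only [LinearMap.sub_apply, LinearMap.id_apply, LinearMap.smulRight_apply,
        LinearMap.smul_apply, smul_eq_mul, map_sub, map_smul]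
      linear_combination (norm := module) (2 / herm E u u * herm E u x) • (congrArg (· • u) h)

theorem reflection_apply (u x : V) :
    reflection E u x = x - (2 / herm E u u * herm E u x) • u := rfl

theorem reflection_apply_of_herm_eq_zero (h : herm E u x = 0) : reflection E u x = x := by
  simp [reflection_apply, h]

theorem reflection_smul {a : ℂ} (ha : a ≠ 0) (u : V) : reflection E (a • u) = reflection E u := by
  ext x
  have ha' : conj a ≠ 0 := (map_ne_zero _).2 ha
  rw [reflection_apply, reflection_apply, smul_smul, LinearMap.map_smulₛₗ₂,
    LinearMap.map_smulₛₗ₂, map_smul]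
  congr 2
  simp only [smul_eq_mul]
  field_simp

theorem reflection_commute (h : herm E u v = 0) : Commute (reflection E u) (reflection E v) := by
  have h' : herm E v u = 0 := by rw [← conj_herm, h, map_zero]
  ext x
  simp only [LinearEquiv.mul_apply, reflection_apply, map_sub, map_smul, h, h']
  module

theorem reflection_mem_unitaryGroup (u : V) : reflection E u ∈ unitaryGroup E := by
  intro x y
  have hx := conj_herm E u x
  have hu := conj_herm E u u
  by_cases h0 : herm E u u = 0
  · simp [reflection_apply, h0]
  · simp only [reflection_apply, map_sub, LinearMap.sub_apply, LinearMap.map_smulₛₗ₂, map_smul,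
      smul_eq_mul, map_mul, map_div₀, hu, hx, map_ofNat]
    field_simp
    ring

theorem reflection_mem_GLinf (E : Module.Basis ℕ+ ℂ V) (u : V) : reflection E u ∈ GLinf E := by
  have hfin : ∀ᶠ ℓ in Filter.cofinite, E.repr u ℓ = 0 :=
    (E.repr u).hasFiniteSupport
  filter_upwards [Filter.atTop_le_cofinite hfin] with ℓ hℓ
  exact reflection_apply_of_herm_eq_zero E (by simp [hℓ])

theorem reflection_mem_GLinf_inf_unitaryGroup (E : Module.Basis ℕ+ ℂ V) (u : V) :
    reflection E u ∈ GLinf E ⊓ unitaryGroup E :=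
  ⟨reflection_mem_GLinf E u, reflection_mem_unitaryGroup E u⟩

theorem reflection_sub_basis {i j : I} (hij : i ≠ j) : reflection E (E i - E j) (E j) = E i := by
  have h : herm E (E i - E j) (E i - E j) = 2 := by
    rw [map_sub, herm_basis_right, herm_basis_right]
    simp [hij, hij.symm, one_add_one_eq_two]
  rw [reflection_apply, h]
  simp [hij]

/-- The reflection in `u = z - e_i + e_j` maps `e_i` and `e_j` to `(e_i + e_j ± z) / 2`. -/
theorem carriesLine_reflection {θ : ℂ →+* ℂ} (f : V →ₛₗ[θ] V) {i j : I} (hij : i ≠ j) {z : V}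
    (hzi : E.repr z i = 0) (hzj : E.repr z j = 0) (hz : herm E z z = 2) {s : ℂ}
    (hi : f (E i) = s • E i) (hj : f (E j) = s • E j) (hfz : f z = -s • z) :
    CarriesLine E f (reflection E (z - E i + E j)) i j := by
  have hu : herm E (z - E i + E j) (z - E i + E j) = 4 := by
    simp [hzi, hzj, hz, hij, hij.symm]
    norm_num
  have hri : reflection E (z - E i + E j) (E i) = (1 / 2 : ℂ) • (E i + E j + z) := by
    have hui : herm E (z - E i + E j) (E i) = -1 := by simp [hzi, hij]
    rw [reflection_apply, hu, hui]
    module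
  have hrj : reflection E (z - E i + E j) (E j) = (1 / 2 : ℂ) • (E i + E j - z) := by
    have huj : herm E (z - E i + E j) (E j) = 1 := by simp [hzj, hij.symm]
    rw [reflection_apply, hu, huj]
    module
  refine ⟨s, ?_⟩
  rw [hri, hrj, map_smulₛₗ, map_add, map_add, hi, hj, hfz, map_div₀, map_one, map_ofNat]
  module

end Reflections

section ReflectionsGamma

variable {V : Type*} [AddCommGroup V] [Module ℂ V] (E : Module.Basis ℕ+ ℂ V) {c : ℂ}
  {ι : ℕ+ → ℕ+} {u : V}

theorem gammaHom_reflection (hc : c = 1 ∨ c = -1) (hι : Function.Involutive ι) (u x : V) :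
    gammaHom E c ι (reflection E u x) =
      reflection E (gammaHom E c ι u) (gammaHom E c ι x) := by
  simp only [reflection_apply, map_sub, map_smulₛₗ, herm_gammaHom_gammaHom E hc hι, map_mul,
    map_div₀, conj_herm, map_ofNat]

theorem unitaryGroup_inf_commuting_gammaHom_le (hc : c = 1 ∨ c = -1)
    (hι : Function.Involutive ι) :
    GLinf E ⊓ unitaryGroup E ⊓ commuting (gammaHom E c ι) ≤ Ginf E c ι := by
  rintro g ⟨⟨hg, hun⟩, hcomm⟩
  refine ⟨hg, fun x y => ?_⟩
  have hy : gammaHom E c ι (g y) = g (gammaHom E c ι y) := hcomm y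
  simpa only [omegaForm_eq_herm_gammaHom E hc hι, hy] using hun (gammaHom E c ι y) x

theorem reflection_mem_Ginf (hc : c = 1 ∨ c = -1) (hι : Function.Involutive ι) {a : ℂ}
    (ha : a ≠ 0) (hu : gammaHom E c ι u = a • u) : reflection E u ∈ Ginf E c ι := by
  refine unitaryGroup_inf_commuting_gammaHom_le E hc hι
    ⟨⟨reflection_mem_GLinf E u, reflection_mem_unitaryGroup E u⟩, fun x => ?_⟩
  rw [gammaHom_reflection E hc hι, hu, reflection_smul E ha]

theorem reflection_mul_reflection_gammaHom_mem_Ginf (hc : c = 1 ∨ c = -1)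
    (hι : Function.Involutive ι) (hfix : ∀ ℓ, ι ℓ ≠ ℓ) (hu : herm E u (gammaHom E c ι u) = 0) :
    reflection E u * reflection E (gammaHom E c ι u) ∈ Ginf E c ι := by
  have hc0 : c ≠ 0 := by rcases hc with rfl | rfl <;> simp
  refine unitaryGroup_inf_commuting_gammaHom_le E hc hι
    ⟨⟨mul_mem (reflection_mem_GLinf E _) (reflection_mem_GLinf E _),
      mul_mem (reflection_mem_unitaryGroup E _) (reflection_mem_unitaryGroup E _)⟩, fun x => ?_⟩
  rw [LinearEquiv.mul_apply, gammaHom_reflection E hc hι, gammaHom_reflection E hc hι,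
    gammaHom_gammaHom E hι hfix hc, reflection_smul E hc0, ← LinearEquiv.mul_apply,
    (reflection_commute E hu).eq]

end ReflectionsGamma

section Orbits

variable {V : Type*} [AddCommGroup V] [Module ℂ V] {A : Type} [LinearOrder A] {σ : ℕ+ → A}
  {E : Module.Basis ℕ+ ℂ V} {c : ℂ} {ι : ℕ+ → ℕ+} {N : Set ℕ+} {G : Subgroup (V ≃ₗ[ℂ] V)}
  {p : ℕ+} {z : V}

theorem infinite_orbitSets_gammaMap (hc : c = 1 ∨ c = -1) (hι : Function.Involutive ι)
    (hmax : IsMaximalGeneralizedFlag (flagOf σ E)) {S : Set ℕ+} (hS : S.Infinite)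
    {g : ℕ+ → V ≃ₗ[ℂ] V} (hg : ∀ n ∈ S, g n ∈ GLinf E ⊓ unitaryGroup E) {k : ℕ+}
    (hcarry : ∀ n ∈ S, CarriesLine E (gammaHom E c ι) (g n) k n) :
    Infinite (OrbitSet (GLinf E) (Ginf E c ι) (flagOf σ E)) ∧
      Infinite (OrbitSet (GLinf E) (GLinf E ⊓ commuting (gammaMap E c ι)) (flagOf σ E)) :=
  (infinite_orbitSets_of_pairwise (f := gammaHom E c ι) hmax
    (fun x y h => by rw [herm_gammaHom_gammaHom E hc hι]; exact herm_ne_zero_symm E h) le_rfl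
    inf_le_left inf_le_right inf_le_left (Ginf_le_preserving_gammaHom E hc hι) hS hg
    fun m hm n hn hmn => ⟨k, m, n, hmn, hcarry m hm, hcarry n hn⟩).symm

theorem infinite_compl_pair (a b : ℕ+) : ({a, b}ᶜ : Set ℕ+).Infinite :=
  (Set.toFinite {a, b}).infinite_compl

theorem infinite_orbitSets_GLinf_of_ne (hc : c = 1 ∨ c = -1) (hι : Function.Involutive ι)
    (hmax : IsMaximalGeneralizedFlag (flagOf σ E)) {i : ℕ+} (hi : ι i ≠ i) :
    Infinite (OrbitSet (GLinf E) (Ginf E c ι) (flagOf σ E)) ∧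
      Infinite (OrbitSet (GLinf E) (GLinf E ⊓ commuting (gammaMap E c ι)) (flagOf σ E)) := by
  refine infinite_orbitSets_gammaMap hc hι hmax (infinite_compl_pair i (ι i)) (k := i)
    (g := fun j => reflection E (E (ι i) - E j))
    (fun j _ => reflection_mem_GLinf_inf_unitaryGroup E _) fun j hj => ⟨Omega c ι (ι i) i, ?_⟩
  have hji : j ≠ i := fun e => hj (Or.inl e)
  have hjι : ι i ≠ j := fun e => hj (Or.inr e.symm)
  have hfixed : reflection E (E (ι i) - E j) (E i) = E i :=
    reflection_apply_of_herm_eq_zero E (by simp [hi.symm, hji.symm])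
  rw [reflection_sub_basis E hjι, hfixed, gammaHom_basis]

theorem infinite_orbitSets_GLinf_of_forall_eq (hc : c = 1 ∨ c = -1) (hid : ∀ ℓ, ι ℓ = ℓ)
    (hmax : IsMaximalGeneralizedFlag (flagOf σ E)) :
    Infinite (OrbitSet (GLinf E) (Ginf E c ι) (flagOf σ E)) ∧
      Infinite (OrbitSet (GLinf E) (GLinf E ⊓ commuting (gammaMap E c ι)) (flagOf σ E)) := by
  have hγ (ℓ : ℕ+) : gammaHom E c ι (E ℓ) = (1 : ℂ) • E ℓ := by
    rw [gammaHom_basis, hid, Omega, if_pos (hid ℓ).symm, if_pos le_rfl]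
  refine infinite_orbitSets_gammaMap hc (fun ℓ => by rw [hid, hid]) hmax (infinite_compl_pair 1 2)
    (k := 2) (g := fun j => reflection E ((√2 * Complex.I : ℂ) • E 1 - E 2 + E j))
    (fun j _ => reflection_mem_GLinf_inf_unitaryGroup E _) fun j hj => ?_
  have hj1 : 1 ≠ j := fun e => hj (Or.inl e.symm)
  have hj2 : 2 ≠ j := fun e => hj (Or.inr e.symm)
  refine carriesLine_reflection E (gammaHom E c ι) hj2 (by simp) (by simp [hj1])
    (by rw [herm_smul_self]; simp) (hγ 2) (hγ j) ?_
  rw [map_smulₛₗ, hγ, map_mul, Complex.conj_ofReal, Complex.conj_I]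
  module

theorem infinite_orbitSets_GLinf (hc : c = 1 ∨ c = -1) (hι : Function.Involutive ι)
    (hmax : IsMaximalGeneralizedFlag (flagOf σ E)) :
    Infinite (OrbitSet (GLinf E) (Ginf E c ι) (flagOf σ E)) ∧
      Infinite (OrbitSet (GLinf E) (GLinf E ⊓ commuting (gammaMap E c ι)) (flagOf σ E)) := by
  by_cases hid : ∀ ℓ, ι ℓ = ℓ
  · exact infinite_orbitSets_GLinf_of_forall_eq hc hid hmax
  · obtain ⟨i, hi⟩ := not_forall.1 hid
    exact infinite_orbitSets_GLinf_of_ne hc hι hmax hi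

theorem infinite_orbitSets_deltaMap_of_pairwise {α : Type*}
    (hmax : IsMaximalGeneralizedFlag (flagOf σ E)) (hG : G ≤ GLinf E) {S : Set α}
    (hS : S.Infinite) {g : α → V ≃ₗ[ℂ] V} (hg : ∀ n ∈ S, g n ∈ G ⊓ unitaryGroup E)
    (hsep : S.Pairwise fun m n => ∃ k i j, i ≠ j ∧ CarriesLine E (deltaMap E N) (g m) k i ∧
      CarriesLine E (deltaMap E N) (g n) k j) :
    Infinite (OrbitSet G (G ⊓ commuting (deltaMap E N)) (flagOf σ E)) ∧
      Infinite (OrbitSet G (G ⊓ preserving (phiForm E N)) (flagOf σ E)) :=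
  infinite_orbitSets_of_pairwise hmax
    (fun x y h => by rwa [herm_deltaMap_deltaMap]) hG inf_le_left inf_le_right inf_le_left
    (by simp only [herm_deltaMap_left]; exact inf_le_right) hS hg hsep

theorem infinite_orbitSets_deltaMap (hmax : IsMaximalGeneralizedFlag (flagOf σ E))
    (hG : G ≤ GLinf E) {S : Set ℕ+} (hS : S.Infinite) {g : ℕ+ → V ≃ₗ[ℂ] V}
    (hg : ∀ n ∈ S, g n ∈ G ⊓ unitaryGroup E) {k : ℕ+}
    (hcarry : ∀ n ∈ S, CarriesLine E (deltaMap E N) (g n) k n) :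
    Infinite (OrbitSet G (G ⊓ commuting (deltaMap E N)) (flagOf σ E)) ∧
      Infinite (OrbitSet G (G ⊓ preserving (phiForm E N)) (flagOf σ E)) :=
  infinite_orbitSets_deltaMap_of_pairwise hmax hG hS hg
    fun m hm n hn hmn => ⟨k, m, n, hmn, hcarry m hm, hcarry n hn⟩

theorem carriesLine_deltaMap_reflection (hzz : herm E z z = 2)
    (hz : deltaMap E N z = sgn N p • z) {i j : ℕ+} (hij : i ≠ j) (hi : sgn N i = -sgn N p)
    (hj : sgn N j = -sgn N p) :
    CarriesLine E (deltaMap E N) (reflection E (z - E i + E j)) i j :=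
  carriesLine_reflection E (deltaMap E N) hij (repr_eq_zero_of_deltaMap_eq_smul hz hi)
    (repr_eq_zero_of_deltaMap_eq_smul hz hj) hzz (by rw [deltaMap_basis, hi])
    (by rw [deltaMap_basis, hj]) (by rw [hz, neg_neg])

theorem infinite_orbitSets_GLinf_deltaMap (pos : N.Nonempty) (neg : Nᶜ.Nonempty)
    (hmax : IsMaximalGeneralizedFlag (flagOf σ E)) :
    Infinite (OrbitSet (GLinf E) (GLinf E ⊓ commuting (deltaMap E N)) (flagOf σ E)) ∧
      Infinite (OrbitSet (GLinf E) (GLinf E ⊓ preserving (phiForm E N)) (flagOf σ E)) := by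
  obtain ⟨p, hp⟩ := exists_infinite_setOf_sgn_eq_neg pos neg
  obtain ⟨i, hi⟩ := hp.nonempty
  refine infinite_orbitSets_deltaMap hmax le_rfl (hp.sdiff (Set.finite_singleton i)) (k := i)
    (g := fun j => reflection E ((√2 : ℂ) • E p - E i + E j))
    (fun j _ => reflection_mem_GLinf_inf_unitaryGroup E _) fun j hj => ?_
  exact carriesLine_deltaMap_reflection (herm_sqrt_two_smul_basis p) (deltaMap_smul_basis E N _ p)
    (Ne.symm hj.2) hi hj.1

theorem infinite_orbitSets_Ginf_of_forall_ne (hc : c = 1 ∨ c = -1) (hι : Function.Involutive ι)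
    (noFix : ∀ ℓ, ι ℓ ≠ ℓ) (pos : N.Nonempty) (neg : Nᶜ.Nonempty)
    (hmax : IsMaximalGeneralizedFlag (flagOf σ E)) :
    Infinite (OrbitSet (Ginf E c ι) (Ginf E c ι ⊓ commuting (deltaMap E N)) (flagOf σ E)) ∧
      Infinite (OrbitSet (Ginf E c ι) (Ginf E c ι ⊓ preserving (phiForm E N)) (flagOf σ E)) := by
  obtain ⟨p, hp⟩ := exists_infinite_setOf_sgn_eq_neg pos neg
  obtain ⟨i, hi, hip⟩ := (hp.sdiff (Set.toFinite {p, ι p})).nonempty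
  let u (j : ℕ+) : V := (√2 : ℂ) • E p - E i + E j
  have hu {j ℓ : ℕ+} (hℓ : ¬(ℓ = p ∨ ℓ = i ∨ ℓ = j)) : E.repr (u j) ℓ = 0 := by
    push Not at hℓ
    simp [u, hℓ, -Complex.coe_smul]
  have hγu {j : ℕ+} (hj : j ∉ ({p, ι p, i, ι i} : Set ℕ+)) {ℓ : ℕ+}
      (hℓ : ℓ = p ∨ ℓ = i ∨ ℓ = j) : E.repr (u j) (ι ℓ) = 0 := by
    have hιi := hι i
    have hιj := hι j
    exact hu (by grind)
  refine infinite_orbitSets_deltaMap hmax inf_le_left (hp.sdiff (Set.toFinite {p, ι p, i, ι i}))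
    (k := i) (g := fun j => reflection E (u j) * reflection E (gammaHom E c ι (u j)))
    (fun j hj => ⟨reflection_mul_reflection_gammaHom_mem_Ginf E hc hι noFix
      (herm_gammaHom_self_eq_zero E hc hι fun ℓ hℓ => hγu hj.2 (not_imp_comm.1 hu hℓ)),
      mul_mem (reflection_mem_unitaryGroup E _) (reflection_mem_unitaryGroup E _)⟩) fun j hj => ?_
  have hfixed {ℓ : ℕ+} (hℓ : ℓ = p ∨ ℓ = i ∨ ℓ = j) :
      reflection E (gammaHom E c ι (u j)) (E ℓ) = E ℓ := by
    refine reflection_apply_of_herm_eq_zero E ?_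
    rw [herm_basis_right, repr_gammaHom_eq_zero E hc hι (hγu hj.2 hℓ), map_zero]
  have hij : i ≠ j := fun e => hj.2 (by simp [e])
  exact (carriesLine_deltaMap_reflection (herm_sqrt_two_smul_basis p)
    (deltaMap_smul_basis E N _ p) hij hi hj.1).mul
      (hfixed (Or.inr (Or.inl rfl))) (hfixed (Or.inr (Or.inr rfl)))

theorem infinite_orbitSets_Ginf_of_swap (hc : c = 1 ∨ c = -1) (hι : Function.Involutive ι)
    (swap : ∀ ℓ, ℓ ∈ N ↔ ι ℓ ∈ Nᶜ) (hmax : IsMaximalGeneralizedFlag (flagOf σ E)) :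
    Infinite (OrbitSet (Ginf E c ι) (Ginf E c ι ⊓ commuting (deltaMap E N)) (flagOf σ E)) ∧
      Infinite (OrbitSet (Ginf E c ι) (Ginf E c ι ⊓ preserving (phiForm E N)) (flagOf σ E)) := by
  have noFix (ℓ : ℕ+) : ι ℓ ≠ ℓ := fun h => iff_not_self (h ▸ swap ℓ)
  by_cases h : (1 : ℕ+) ∈ N
  · exact infinite_orbitSets_Ginf_of_forall_ne hc hι noFix ⟨1, h⟩ ⟨ι 1, (swap 1).1 h⟩ hmax
  · exact infinite_orbitSets_Ginf_of_forall_ne hc hι noFix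
      ⟨ι 1, not_not.1 (mt (swap 1).2 h)⟩ ⟨1, h⟩ hmax

theorem exists_gammaHom_eq_self (hι : Function.Involutive ι) (stable : ∀ ℓ, ℓ ∈ N ↔ ι ℓ ∈ N)
    (p : ℕ+) :
    ∃ z : V, gammaHom E 1 ι z = z ∧ deltaMap E N z = sgn N p • z ∧ herm E z z = 2 := by
  by_cases hp : ι p = p
  · refine ⟨(√2 : ℂ) • E p, ?_, deltaMap_smul_basis E N _ p, herm_sqrt_two_smul_basis p⟩
    rw [map_smulₛₗ, gammaHom_one_basis E hι, hp, Complex.conj_ofReal]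
  · refine ⟨E p + E (ι p), ?_, ?_, ?_⟩
    · rw [map_add, gammaHom_one_basis E hι, gammaHom_one_basis E hι, hι, add_comm]
    · rw [map_add, deltaMap_basis, deltaMap_basis, sgn_apply_of_mem_iff stable, smul_add]
    · simp [hp, Ne.symm hp, one_add_one_eq_two]

theorem infinite_setOf_mem_and_lt {α : Type*} [LinearOrder α] {T : Set α} {ι : α → α}
    (hι : Function.Involutive ι) (hT : ∀ k ∈ T, ι k ∈ T) (h : {k ∈ T | ι k ≠ k}.Infinite) :
    {k ∈ T | k < ι k}.Infinite := by
  intro hfin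
  refine h ((hfin.union (hfin.image ι)).subset ?_)
  rintro k ⟨hk, hne⟩
  rcases hne.lt_or_gt with hlt | hgt
  · exact Or.inr ⟨ι k, ⟨hT k hk, (hι k).symm ▸ hlt⟩, hι k⟩
  · exact Or.inl ⟨hk, hgt⟩

theorem infinite_orbitSets_Ginf_of_infinite_fixed (hι : Function.Involutive ι)
    (hmax : IsMaximalGeneralizedFlag (flagOf σ E)) (hγz : gammaHom E 1 ι z = z)
    (hδz : deltaMap E N z = sgn N p • z) (hzz : herm E z z = 2)
    (hT : {i | sgn N i = -sgn N p ∧ ι i = i}.Infinite) :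
    Infinite (OrbitSet (Ginf E 1 ι) (Ginf E 1 ι ⊓ commuting (deltaMap E N)) (flagOf σ E)) ∧
      Infinite (OrbitSet (Ginf E 1 ι) (Ginf E 1 ι ⊓ preserving (phiForm E N)) (flagOf σ E)) := by
  obtain ⟨i, hi, hιi⟩ := hT.nonempty
  refine infinite_orbitSets_deltaMap hmax inf_le_left (hT.sdiff (Set.finite_singleton i)) (k := i)
    (g := fun j => reflection E (z - E i + E j))
    (fun j hj => ⟨reflection_mem_Ginf E (Or.inl rfl) hι one_ne_zero ?_,
      reflection_mem_unitaryGroup E _⟩)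
    fun j hj => carriesLine_deltaMap_reflection hzz hδz (Ne.symm hj.2) hi hj.1.1
  rw [map_add, map_sub, hγz, gammaHom_one_basis E hι, gammaHom_one_basis E hι, hιi, hj.1.2,
    one_smul]

theorem infinite_orbitSets_Ginf_of_infinite_lt (hι : Function.Involutive ι)
    (stable : ∀ ℓ, ℓ ∈ N ↔ ι ℓ ∈ N) (hmax : IsMaximalGeneralizedFlag (flagOf σ E))
    (hγz : gammaHom E 1 ι z = z) (hδz : deltaMap E N z = sgn N p • z) (hzz : herm E z z = 2)
    (hT : {k | sgn N k = -sgn N p ∧ k < ι k}.Infinite) :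
    Infinite (OrbitSet (Ginf E 1 ι) (Ginf E 1 ι ⊓ commuting (deltaMap E N)) (flagOf σ E)) ∧
      Infinite (OrbitSet (Ginf E 1 ι) (Ginf E 1 ι ⊓ preserving (phiForm E N)) (flagOf σ E)) := by
  refine infinite_orbitSets_deltaMap_of_pairwise hmax inf_le_left hT
    (g := fun k => reflection E (Complex.I • z - E k + E (ι k)))
    (fun _ _ => ⟨reflection_mem_Ginf E (a := -1) (Or.inl rfl) hι (by simp) ?_,
      reflection_mem_unitaryGroup E _⟩)
    fun m hm n hn hmn => ⟨m, ι m, m, hm.2.ne', ?_, sgn N m, ?_⟩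
  · rw [map_add, map_sub, map_smulₛₗ, hγz, gammaHom_one_basis E hι, gammaHom_one_basis E hι, hι,
      Complex.conj_I]
    module
  · refine carriesLine_deltaMap_reflection ?_ ?_ hm.2.ne hm.1
      ((sgn_apply_of_mem_iff stable m).trans hm.1)
    · rw [herm_smul_self, hzz, Complex.normSq_I, Complex.ofReal_one, one_mul]
    · rw [map_smul, hδz, smul_comm]
  · have hmn' : m ≠ ι n := fun e => (hn.2.trans_eq e.symm).asymm (hm.2.trans_eq (by rw [e, hι]))
    have hfixed : reflection E (Complex.I • z - E n + E (ι n)) (E m) = E m := by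
      refine reflection_apply_of_herm_eq_zero E ?_
      simp [repr_eq_zero_of_deltaMap_eq_smul hδz hm.1, hmn, hmn']
    rw [hfixed, deltaMap_basis]

theorem infinite_orbitSets_Ginf_of_stable (hι : Function.Involutive ι)
    (stable : ∀ ℓ, ℓ ∈ N ↔ ι ℓ ∈ N) (pos : N.Nonempty) (neg : Nᶜ.Nonempty)
    (hmax : IsMaximalGeneralizedFlag (flagOf σ E)) :
    Infinite (OrbitSet (Ginf E 1 ι) (Ginf E 1 ι ⊓ commuting (deltaMap E N)) (flagOf σ E)) ∧
      Infinite (OrbitSet (Ginf E 1 ι) (Ginf E 1 ι ⊓ preserving (phiForm E N)) (flagOf σ E)) := by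
  obtain ⟨p, hp⟩ := exists_infinite_setOf_sgn_eq_neg pos neg
  obtain ⟨z, hγz, hδz, hzz⟩ := exists_gammaHom_eq_self (E := E) hι stable p
  by_cases hfixed : {i | sgn N i = -sgn N p ∧ ι i = i}.Infinite
  · exact infinite_orbitSets_Ginf_of_infinite_fixed hι hmax hγz hδz hzz hfixed
  · refine infinite_orbitSets_Ginf_of_infinite_lt hι stable hmax hγz hδz hzz
      (infinite_setOf_mem_and_lt hι (fun k hk => (sgn_apply_of_mem_iff stable k).trans hk) ?_)
    refine (hp.sdiff (Set.not_infinite.1 hfixed)).mono fun k hk => ⟨hk.1, fun h => hk.2 ⟨hk.1, h⟩⟩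

end Orbits

end IndFlag

theorem corollary5p2_general {V : Type*} [AddCommGroup V] [Module ℂ V] (E : Module.Basis ℕ+ ℂ V)
    (D : IndFlag.Datum) (𝓕 : Set (Submodule ℂ V))
    (hmax : IndFlag.IsMaximalGeneralizedFlag 𝓕)
    (hcompat : IndFlag.IsCompatible 𝓕 E) :
    Infinite (IndFlag.OrbitSet (D.G E) (D.K E) 𝓕) ∧
      Infinite (IndFlag.OrbitSet (D.G E) (D.G0 E) 𝓕) := by
  open IndFlag in
  obtain ⟨A, _, σ, -, rfl⟩ := hcompat
  cases D with
  | A1 ι block => exact infinite_orbitSets_GLinf (Or.inl rfl) block.involutive hmax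
  | A2 ι block => exact infinite_orbitSets_GLinf (Or.inr rfl) block.involutive hmax
  | A3 N pos neg => exact infinite_orbitSets_GLinf_deltaMap pos neg hmax
  | BD1 ι block N pos neg stable =>
    exact infinite_orbitSets_Ginf_of_stable block.involutive stable pos neg hmax
  | C1 ι block noFix N swap =>
    exact infinite_orbitSets_Ginf_of_swap (Or.inr rfl) block.involutive swap hmax
  | C2 ι block noFix N pos neg stable =>
    exact infinite_orbitSets_Ginf_of_forall_ne (Or.inr rfl) block.involutive noFix pos neg hmax
  | D3 ι block N swap =>
    exact infinite_orbitSets_Ginf_of_swap (Or.inl rfl) block.involutive swap hmax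

theorem corollary5p2 {V : Type*} [AddCommGroup V] [Module ℂ V] (E : Module.Basis ℕ+ ℂ V)
    (D : IndFlag.Datum) (𝓕 : Set (Submodule ℂ V))
    (hmax : IndFlag.IsMaximalGeneralizedFlag 𝓕)
    (hcompat : IndFlag.IsCompatible 𝓕 E)
    (hiso : D.IsotropyCondition E 𝓕) :
    Infinite (IndFlag.OrbitSet (D.G E) (D.K E) 𝓕) ∧
      Infinite (IndFlag.OrbitSet (D.G E) (D.G0 E) 𝓕) :=
  corollary5p2_general E D 𝓕 hmax hcompat
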